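/- A real $2\times2\times2$ tensor is an array $T=(t_{ijk})_{i,j,k\in\{0,1\}}\in\mathbb R^2\otimes\mathbb R^2\otimes\mathbb R^2$. Its subrank $Q(T)$ is the largest $r$ for which there are linear maps $\varphi_1,\varphi_2,\varphi_3:\mathbb R^2\to\mathbb R^r$ with $(\varphi_1\otimes\varphi_2\otimes\varphi_3)T=\sum_{j=1}^r e_j\otimes e_j\otimes e_j$, and its rank $R(T)$ is the smallest $r$ for which $T$ is a sum of $r$ tensors $u\otimes v\otimes w$ with $u,v,w\in\mathbb R^2$. A number $r$ is a typical subrank if the set of tensors with $Q(T)=r$ contains a nonempty open subset in the Euclidean topology. Let $$\begin{aligned}\Delta(T)={}&t_{000}^2t_{111}^2+t_{001}^2t_{110}^2+t_{010}^2t_{101}^2+t_{100}^2t_{011}^2\\&-2\bigl(t_{000}t_{001}t_{110}t_{111}+t_{000}t_{010}t_{101}t_{111}+t_{000}t_{100}t_{011}t_{111}+t_{001}t_{010}t_{101}t_{110}+t_{001}t_{100}t_{011}t_{110}+t_{010}t_{100}t_{011}t_{101}\bigr)\\&+4\bigl(t_{000}t_{011}t_{101}t_{110}+t_{001}t_{010}t_{100}t_{111}\bigr)\end{aligned}$$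 be the Cayley hyperdeterminant. **Proposition 4.2.** 1. The typical subranks of real $2\times2\times2$ tensors are exactly $1$ and $2$. 2. If the entries $t_{ijk}$ of $T$ are independent Gaussian random variables with mean $0$ and common variance $v>0$, then $\mathbf P(Q(T)=2)=\frac{\pi}{4}$. 3. For every real $2\times2\times2$ tensor $T$, $Q(T)=2$ if and only if $\Delta(T)>0$. If moreover $\Delta(T)\neq0$ (which excludes only a proper algebraic subset of tensors), then $Q(T)=2$ if and only if $R(T)=2$. -/

import Mathlib

open MeasureTheory ProbabilityTheory
open scoped NNReal

/-- Real tensors of format `n₁ × n₂ × n₃`, i.e. elements of `ℝ^n₁ ⊗ ℝ^n₂ ⊗ ℝ^n₃`, given by their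
coordinates in the standard basis. The topology is the product (Euclidean) topology. -/
abbrev RealTensor (n₁ n₂ n₃ : ℕ) : Type := Fin n₁ → Fin n₂ → Fin n₃ → ℝ

namespace RealTensor

variable {n₁ n₂ n₃ : ℕ}

/-- `(φ₁ ⊗ φ₂ ⊗ φ₃) T` for linear maps `φ₁ : ℝ^n₁ → ℝ^m₁`, `φ₂ : ℝ^n₂ → ℝ^m₂`, `φ₃ : ℝ^n₃ → ℝ^m₃`
given by their matrices `A`, `B`, `C`. -/
def transform {m₁ m₂ m₃ : ℕ} (A : Matrix (Fin m₁) (Fin n₁) ℝ) (B : Matrix (Fin m₂) (Fin n₂) ℝ)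
    (C : Matrix (Fin m₃) (Fin n₃) ℝ) (T : RealTensor n₁ n₂ n₃) : RealTensor m₁ m₂ m₃ :=
  fun a b c => ∑ i, ∑ j, ∑ k, A a i * B b j * C c k * T i j k

/-- The `r`-th unit tensor `I_r = ∑_j e_j ⊗ e_j ⊗ e_j`. -/
def unit (r : ℕ) : RealTensor r r r :=
  fun a b c => if a = b ∧ b = c then 1 else 0

/-- The subrank `Q(T)`: the largest `r` such that `T` can be mapped to `I_r` by a triple of linear
maps. (The set always contains `0` and is bounded above by each `nᵢ`, so the supremum
is a maximum.) -/
noncomputable def subrank (T : RealTensor n₁ n₂ n₃) : ℕ :=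
  sSup {r : ℕ | ∃ (A : Matrix (Fin r) (Fin n₁) ℝ) (B : Matrix (Fin r) (Fin n₂) ℝ)
    (C : Matrix (Fin r) (Fin n₃) ℝ), transform A B C T = unit r}

/-- The (real) rank `R(T)`: the smallest `r` such that `T` is a sum of `r` tensors of the form
`u ⊗ v ⊗ w`. -/
noncomputable def rank (T : RealTensor n₁ n₂ n₃) : ℕ :=
  sInf {r : ℕ | ∃ (u : Fin r → Fin n₁ → ℝ) (v : Fin r → Fin n₂ → ℝ) (w : Fin r → Fin n₃ → ℝ),
    ∀ i j k, T i j k = ∑ l, u l i * v l j * w l k}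

/-- `r` is a typical subrank of the format `n₁ × n₂ × n₃` if the set of tensors of subrank `r`
contains a nonempty open subset. -/
def IsTypicalSubrank (n₁ n₂ n₃ r : ℕ) : Prop :=
  ∃ U : Set (RealTensor n₁ n₂ n₃), IsOpen U ∧ U.Nonempty ∧ U ⊆ {T | subrank T = r}

/-- The Cayley hyperdeterminant of a `2 × 2 × 2` tensor. -/
def hyperdet (T : RealTensor 2 2 2) : ℝ :=
  T 0 0 0 ^ 2 * T 1 1 1 ^ 2 + T 0 0 1 ^ 2 * T 1 1 0 ^ 2
    + T 0 1 0 ^ 2 * T 1 0 1 ^ 2 + T 1 0 0 ^ 2 * T 0 1 1 ^ 2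
    - 2 * (T 0 0 0 * T 0 0 1 * T 1 1 0 * T 1 1 1 + T 0 0 0 * T 0 1 0 * T 1 0 1 * T 1 1 1
      + T 0 0 0 * T 1 0 0 * T 0 1 1 * T 1 1 1 + T 0 0 1 * T 0 1 0 * T 1 0 1 * T 1 1 0
      + T 0 0 1 * T 1 0 0 * T 0 1 1 * T 1 1 0 + T 0 1 0 * T 1 0 0 * T 0 1 1 * T 1 0 1)
    + 4 * (T 0 0 0 * T 0 1 1 * T 1 0 1 * T 1 1 0 + T 0 0 1 * T 0 1 0 * T 1 0 0 * T 1 1 1)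

end RealTensor

/-!
A positive hyperdeterminant means that the pencil `det (x T₀ + y T₁)` of the two slices of `T`
splits into two distinct real linear factors, i.e. that `T` is equivalent to the unit tensor `I₂`;
this is also what makes the rank equal to `2` when the hyperdeterminant does not vanish.

For the probability, read the slices as quaternions `α` and `β`. Then
`Δ(T) = ‖Im (α β̄)‖² - ⟪Im (α β̄), i⟫² - ⟪Im (ᾱ β), j⟫²`, where `Im (α β̄)` and `Im (ᾱ β)` have the
same length. The law of a standard Gaussian pair `(α, β)` is invariant under
`(α, β) ↦ (l α r, l β r)` for unit quaternions `l` and `r`, which rotate `Im (α β̄)` and `Im (ᾱ β)`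
separately. For random `l` and `r` the two directions are independent and uniform on the sphere, so
by Archimedes' theorem their coordinates along `i` and `j` are independent and uniform on
`[-1, 1]`, and `Δ(T)` is positive exactly when this point of the square `[-1, 1]²` lies in the unit
disc.
-/

namespace RealTensor

section Restriction

variable {n₁ n₂ n₃ m₁ m₂ m₃ k₁ k₂ k₃ r : ℕ}

theorem transform_one (T : RealTensor n₁ n₂ n₃) : transform 1 1 1 T = T := by
  funext a b c
  simp [transform, Matrix.one_apply, Finset.sum_ite_eq]

theorem transform_transform (A' : Matrix (Fin k₁) (Fin m₁) ℝ) (B' : Matrix (Fin k₂) (Fin m₂) ℝ)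
    (C' : Matrix (Fin k₃) (Fin m₃) ℝ) (A : Matrix (Fin m₁) (Fin n₁) ℝ)
    (B : Matrix (Fin m₂) (Fin n₂) ℝ) (C : Matrix (Fin m₃) (Fin n₃) ℝ) (T : RealTensor n₁ n₂ n₃) :
    transform A' B' C' (transform A B C T) = transform (A' * A) (B' * B) (C' * C) T := by
  funext a b c
  let term (p : Fin m₁ × Fin m₂ × Fin m₃) (q : Fin n₁ × Fin n₂ × Fin n₃) : ℝ :=
    A' a p.1 * A p.1 q.1 * (B' b p.2.1 * B p.2.1 q.2.1) * (C' c p.2.2 * C p.2.2 q.2.2) *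
      T q.1 q.2.1 q.2.2
  calc transform A' B' C' (transform A B C T) a b c = ∑ p, ∑ q, term p q := by
        simp only [transform, term, Fintype.sum_prod_type, Finset.mul_sum]
        congr! 6
        ring
    _ = ∑ q, ∑ p, term p q := Finset.sum_comm
    _ = transform (A' * A) (B' * B) (C' * C) T a b c := by
        simp only [transform, term, Matrix.mul_apply, Fintype.sum_prod_type, Finset.sum_mul_sum,
          ← Finset.sum_mul]
        simp only [← Finset.mul_sum, ← Finset.sum_mul]

/-- The restriction preorder on tensors: `T.RestrictsTo S` is the paper's `S ≤ T`. -/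
def RestrictsTo (T : RealTensor n₁ n₂ n₃) (S : RealTensor m₁ m₂ m₃) : Prop :=
  ∃ (A : Matrix (Fin m₁) (Fin n₁) ℝ) (B : Matrix (Fin m₂) (Fin n₂) ℝ)
    (C : Matrix (Fin m₃) (Fin n₃) ℝ), transform A B C T = S

theorem RestrictsTo.trans {T : RealTensor n₁ n₂ n₃} {S : RealTensor m₁ m₂ m₃}
    {R : RealTensor k₁ k₂ k₃} (hTS : T.RestrictsTo S) (hSR : S.RestrictsTo R) :
    T.RestrictsTo R := by
  obtain ⟨A, B, C, rfl⟩ := hTS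
  obtain ⟨A', B', C', rfl⟩ := hSR
  exact ⟨A' * A, B' * B, C' * C, (transform_transform ..).symm⟩

theorem transform_restrictsTo {A : Matrix (Fin n₁) (Fin n₁) ℝ} {B : Matrix (Fin n₂) (Fin n₂) ℝ}
    {C : Matrix (Fin n₃) (Fin n₃) ℝ} (hA : IsUnit A.det) (hB : IsUnit B.det) (hC : IsUnit C.det)
    (T : RealTensor n₁ n₂ n₃) : (transform A B C T).RestrictsTo T :=
  ⟨A⁻¹, B⁻¹, C⁻¹, by
    rw [transform_transform, Matrix.nonsing_inv_mul _ hA, Matrix.nonsing_inv_mul _ hB,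
      Matrix.nonsing_inv_mul _ hC, transform_one]⟩

theorem transform_unit (A : Matrix (Fin n₁) (Fin r) ℝ) (B : Matrix (Fin n₂) (Fin r) ℝ)
    (C : Matrix (Fin n₃) (Fin r) ℝ) (i : Fin n₁) (j : Fin n₂) (k : Fin n₃) :
    transform A B C (unit r) i j k = ∑ l, A i l * B j l * C k l := by
  simp [transform, unit, ite_and]

theorem unit_restrictsTo_iff {T : RealTensor n₁ n₂ n₃} :
    (unit r).RestrictsTo T ↔
      ∃ (u : Fin r → Fin n₁ → ℝ) (v : Fin r → Fin n₂ → ℝ) (w : Fin r → Fin n₃ → ℝ),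
        ∀ i j k, T i j k = ∑ l, u l i * v l j * w l k := by
  constructor
  · rintro ⟨A, B, C, rfl⟩
    exact ⟨A.transpose, B.transpose, C.transpose, transform_unit A B C⟩
  · rintro ⟨u, v, w, h⟩
    refine ⟨(Matrix.of u).transpose, (Matrix.of v).transpose, (Matrix.of w).transpose, ?_⟩
    funext i j k
    rw [h, transform_unit]
    rfl

theorem rank_eq_sInf (T : RealTensor n₁ n₂ n₃) :
    rank T = sInf {r | (unit r).RestrictsTo T} := by
  simp only [rank, unit_restrictsTo_iff]

theorem RestrictsTo.unit_le {T : RealTensor n₁ n₂ n₃} (h : T.RestrictsTo (unit r)) : r ≤ n₁ := by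
  obtain ⟨A, B, C, h⟩ := h
  suffices hA : LinearIndependent ℝ A.row by simpa using hA.fintype_card_le_finrank
  refine Fintype.linearIndependent_iff.2 fun g hg b => ?_
  have hcol (i : Fin n₁) : ∑ a, g a * A a i = 0 := by
    simpa [Matrix.row] using congrFun hg i
  calc g b = ∑ a, g a * transform A B C T a b b := by simp [h, unit]
    _ = ∑ i, ∑ a, g a * A a i * ∑ j, ∑ k, B b j * C b k * T i j k := by
        rw [Finset.sum_comm]
        simp only [transform, Finset.mul_sum, mul_assoc]
    _ = 0 := by simp only [← Finset.sum_mul, hcol, zero_mul, Finset.sum_const_zero]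

theorem bddAbove_restrictsTo_unit (T : RealTensor n₁ n₂ n₃) :
    BddAbove {r | T.RestrictsTo (unit r)} :=
  ⟨n₁, fun _ => RestrictsTo.unit_le⟩

theorem restrictsTo_unit_subrank (T : RealTensor n₁ n₂ n₃) : T.RestrictsTo (unit T.subrank) :=
  Nat.sSup_mem (s := {r | T.RestrictsTo (unit r)}) ⟨0, 0, 0, 0, funext fun a => a.elim0⟩
    (bddAbove_restrictsTo_unit T)

theorem subrank_le (T : RealTensor n₁ n₂ n₃) : T.subrank ≤ n₁ :=
  (restrictsTo_unit_subrank T).unit_le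

theorem RestrictsTo.le_subrank {T : RealTensor n₁ n₂ n₃} (h : T.RestrictsTo (unit r)) :
    r ≤ T.subrank :=
  le_csSup (bddAbove_restrictsTo_unit T) h

theorem one_le_subrank {T : RealTensor n₁ n₂ n₃} (hT : T ≠ 0) : 1 ≤ T.subrank := by
  obtain ⟨i, j, k, h⟩ : ∃ i j k, T i j k ≠ 0 := by
    simpa only [ne_eq, funext_iff, Pi.zero_apply, not_forall] using hT
  refine RestrictsTo.le_subrank ⟨fun _ => Pi.single i (T i j k)⁻¹, fun _ => Pi.single j 1,
    fun _ => Pi.single k 1, ?_⟩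
  funext a b c
  simp [transform, unit, Subsingleton.elim a b, Subsingleton.elim b c, Pi.single_apply, h]

end Restriction

section Hyperdeterminant

variable {T : RealTensor 2 2 2}

theorem hyperdet_transform_fst (A : Matrix (Fin 2) (Fin 2) ℝ) (T : RealTensor 2 2 2) :
    hyperdet (transform A 1 1 T) = A.det ^ 2 * hyperdet T := by
  have h (a j k : Fin 2) : transform A 1 1 T a j k = A a 0 * T 0 j k + A a 1 * T 1 j k := by
    simp [transform, Matrix.one_apply]
  simp only [hyperdet, h, Matrix.det_fin_two]
  ring

theorem hyperdet_transform_snd (B : Matrix (Fin 2) (Fin 2) ℝ) (T : RealTensor 2 2 2) :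
    hyperdet (transform 1 B 1 T) = B.det ^ 2 * hyperdet T := by
  have h (i b k : Fin 2) : transform 1 B 1 T i b k = B b 0 * T i 0 k + B b 1 * T i 1 k := by
    simp [transform, Matrix.one_apply]
  simp only [hyperdet, h, Matrix.det_fin_two]
  ring

theorem hyperdet_transform_trd (C : Matrix (Fin 2) (Fin 2) ℝ) (T : RealTensor 2 2 2) :
    hyperdet (transform 1 1 C T) = C.det ^ 2 * hyperdet T := by
  have h (i j c : Fin 2) : transform 1 1 C T i j c = C c 0 * T i j 0 + C c 1 * T i j 1 := by
    simp [transform, Matrix.one_apply]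
  simp only [hyperdet, h, Matrix.det_fin_two]
  ring

theorem hyperdet_transform (A B C : Matrix (Fin 2) (Fin 2) ℝ) (T : RealTensor 2 2 2) :
    hyperdet (transform A B C T) = (A.det * B.det * C.det) ^ 2 * hyperdet T := by
  let I : Matrix (Fin 2) (Fin 2) ℝ := 1
  have h : transform A B C T = transform A I I (transform I B I (transform I I C T)) := by
    simp only [I, transform_transform, mul_one, one_mul]
  rw [h, hyperdet_transform_fst, hyperdet_transform_snd, hyperdet_transform_trd]
  ring

theorem hyperdet_unit : hyperdet (unit 2) = 1 := by
  simp [hyperdet, unit]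

theorem continuous_hyperdet : Continuous hyperdet := by
  unfold hyperdet
  fun_prop

theorem RestrictsTo.hyperdet_pos (h : T.RestrictsTo (unit 2)) : 0 < hyperdet T := by
  obtain ⟨A, B, C, h⟩ := h
  have hdet : 0 < (A.det * B.det * C.det) ^ 2 * hyperdet T := by
    rw [← hyperdet_transform, h, hyperdet_unit]
    exact one_pos
  exact pos_of_mul_pos_right hdet (sq_nonneg _)

theorem RestrictsTo.hyperdet_nonneg (h : (unit 2).RestrictsTo T) : 0 ≤ hyperdet T := by
  obtain ⟨A, B, C, rfl⟩ := h
  rw [hyperdet_transform, hyperdet_unit, mul_one]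
  exact sq_nonneg _

theorem RestrictsTo.symm_of_hyperdet_ne_zero (h : (unit 2).RestrictsTo T)
    (hT : hyperdet T ≠ 0) : T.RestrictsTo (unit 2) := by
  obtain ⟨A, B, C, rfl⟩ := h
  rw [hyperdet_transform, hyperdet_unit, mul_one, pow_ne_zero_iff two_ne_zero, mul_ne_zero_iff,
    mul_ne_zero_iff] at hT
  obtain ⟨⟨hA, hB⟩, hC⟩ := hT
  exact transform_restrictsTo hA.isUnit hB.isUnit hC.isUnit _

theorem exists_eq_vecMulVec_of_det_eq_zero {K : Type*} [Field K] {M : Matrix (Fin 2) (Fin 2) K}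
    (hM : M.det = 0) : ∃ v w : Fin 2 → K, M = Matrix.vecMulVec v w := by
  rw [Matrix.det_fin_two, sub_eq_zero] at hM
  by_cases h₀ : M 0 0 = 0
  · have h : M 0 1 = 0 ∨ M 1 0 = 0 := by simpa [h₀] using hM.symm
    rcases h with h | h
    · refine ⟨![0, 1], M 1, ?_⟩
      ext i j
      fin_cases i <;> fin_cases j <;> simp [Matrix.vecMulVec, h₀, h]
    · refine ⟨fun i => M i 1, ![0, 1], ?_⟩
      ext i j
      fin_cases i <;> fin_cases j <;> simp [Matrix.vecMulVec, h₀, h]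
  · refine ⟨![1, M 1 0 / M 0 0], M 0, ?_⟩
    ext i j
    fin_cases i <;> fin_cases j <;>
      simp only [Fin.zero_eta, Fin.mk_one, Matrix.vecMulVec, Matrix.of_apply,
        Matrix.cons_val_zero, Matrix.cons_val_one, one_mul] <;> field_simp
    linear_combination hM

theorem unit_restrictsTo_of_slices_det_eq_zero {r : ℕ} {S : RealTensor r 2 2}
    (hS : ∀ l, (Matrix.of (S l)).det = 0) : (unit r).RestrictsTo S := by
  choose v w h using fun l => exists_eq_vecMulVec_of_det_eq_zero (hS l)
  refine unit_restrictsTo_iff.2 ⟨fun l => Pi.single l 1, v, w, fun i j k => ?_⟩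
  have hjk : S i j k = v i j * w i k := congrFun₂ (h i) j k
  simp [hjk, Pi.single_apply]

theorem exists_det_ne_zero_quadratic_zeros {a b c : ℝ} (h : 0 < b ^ 2 - 4 * a * c) :
    ∃ G : Matrix (Fin 2) (Fin 2) ℝ, G.det ≠ 0 ∧
      ∀ l, a * G l 0 ^ 2 + b * G l 0 * G l 1 + c * G l 1 ^ 2 = 0 := by
  -- The sign of the root is chosen such that `b` and `t` do not cancel, so that no case
  -- distinction on `a = 0` is needed.
  obtain ⟨t, ht, ht₀, hbt⟩ : ∃ t, t ^ 2 = b ^ 2 - 4 * a * c ∧ t ≠ 0 ∧ b + t ≠ 0 := by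
    have hs := Real.sqrt_pos.2 h
    rcases le_or_gt 0 b with hb | hb
    · exact ⟨√(b ^ 2 - 4 * a * c), Real.sq_sqrt h.le, hs.ne', by positivity⟩
    · exact ⟨-√(b ^ 2 - 4 * a * c), by rw [neg_sq, Real.sq_sqrt h.le], neg_ne_zero.2 hs.ne',
        (by linarith : b + -√(b ^ 2 - 4 * a * c) < 0).ne⟩
  refine ⟨!![-(b + t), 2 * a; 2 * c, -(b + t)], ?_, Fin.forall_fin_two.2 ⟨?_, ?_⟩⟩
  · have hdet : (!![-(b + t), 2 * a; 2 * c, -(b + t)] : Matrix (Fin 2) (Fin 2) ℝ).det =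
        2 * t * (b + t) := by
      rw [Matrix.det_fin_two_of]
      linear_combination -ht
    rw [hdet]
    positivity
  · simp only [Matrix.of_apply, Matrix.cons_val_zero, Matrix.cons_val_one]
    linear_combination a * ht
  · simp only [Matrix.of_apply, Matrix.cons_val_zero, Matrix.cons_val_one]
    linear_combination c * ht

theorem unit_two_restrictsTo_of_hyperdet_pos (hT : 0 < hyperdet T) :
    (unit 2).RestrictsTo T := by
  let a := T 0 0 0 * T 0 1 1 - T 0 0 1 * T 0 1 0
  let b := T 0 0 0 * T 1 1 1 + T 1 0 0 * T 0 1 1 - T 0 0 1 * T 1 1 0 - T 1 0 1 * T 0 1 0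
  let c := T 1 0 0 * T 1 1 1 - T 1 0 1 * T 1 1 0
  have hdisc : hyperdet T = b ^ 2 - 4 * a * c := by
    simp only [hyperdet, a, b, c]
    ring
  obtain ⟨G, hG, hzero⟩ := exists_det_ne_zero_quadratic_zeros (hdisc ▸ hT)
  let S : RealTensor 2 2 2 := transform G 1 1 T
  have hslice (l j k : Fin 2) : S l j k = G l 0 * T 0 j k + G l 1 * T 1 j k := by
    simp [S, transform, Matrix.one_apply]
  have hunit : (unit 2).RestrictsTo S := by
    refine unit_restrictsTo_of_slices_det_eq_zero fun l => ?_
    simp only [Matrix.det_fin_two, Matrix.of_apply, hslice]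
    linear_combination hzero l
  exact hunit.trans (transform_restrictsTo hG.isUnit (by simp) (by simp) T)

theorem restrictsTo_unit_two_iff : T.RestrictsTo (unit 2) ↔ 0 < hyperdet T :=
  ⟨RestrictsTo.hyperdet_pos, fun hT =>
    (unit_two_restrictsTo_of_hyperdet_pos hT).symm_of_hyperdet_ne_zero hT.ne'⟩

theorem subrank_eq_two_iff (T : RealTensor 2 2 2) : subrank T = 2 ↔ 0 < hyperdet T := by
  rw [← restrictsTo_unit_two_iff]
  exact ⟨fun h => h.subst (motive := fun r => T.RestrictsTo (unit r))
    (restrictsTo_unit_subrank T), fun h => (subrank_le T).antisymm h.le_subrank⟩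

theorem hyperdet_eq_zero_of_unit_restrictsTo {r : ℕ} (h : (unit r).RestrictsTo T) (hr : r < 2) :
    hyperdet T = 0 := by
  obtain ⟨u, v, w, h⟩ := unit_restrictsTo_iff.1 h
  interval_cases r
  · simp [hyperdet, h]
  · simp only [hyperdet, h, Finset.univ_unique, Finset.sum_singleton]
    ring

theorem rank_eq_two_iff (hT : hyperdet T ≠ 0) : rank T = 2 ↔ 0 < hyperdet T := by
  rw [rank_eq_sInf]
  constructor
  · intro h
    have hmem : (unit 2).RestrictsTo T := by
      simpa [h] using Nat.sInf_mem (Nat.nonempty_of_sInf_eq_succ h)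
    exact hmem.hyperdet_nonneg.lt_of_ne' hT
  · intro h
    have hmem := unit_two_restrictsTo_of_hyperdet_pos h
    refine le_antisymm (Nat.sInf_le hmem) (le_csInf ⟨2, hmem⟩ fun r hr => ?_)
    by_contra! hlt
    exact hT (hyperdet_eq_zero_of_unit_restrictsTo hr hlt)

theorem subrank_eq_one_of_hyperdet_neg (hT : hyperdet T < 0) : subrank T = 1 := by
  have hpos : 1 ≤ subrank T := one_le_subrank (by rintro rfl; simp [hyperdet] at hT)
  have hne : subrank T ≠ 2 := fun h => hT.not_gt ((subrank_eq_two_iff T).1 h)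
  have hle := subrank_le T
  omega

theorem not_isTypicalSubrank_zero {n₁ n₂ n₃ : ℕ} [NeZero n₁] [NeZero n₂] [NeZero n₃] :
    ¬ IsTypicalSubrank n₁ n₂ n₃ 0 := by
  rintro ⟨U, hU, ⟨T, hT⟩, hsub⟩
  have hzero : ∀ S ∈ U, S = 0 := fun S hS => by
    by_contra hS₀
    exact Nat.one_le_iff_ne_zero.1 (one_le_subrank hS₀) (hsub hS)
  have hU₀ : U = {0} := Set.eq_singleton_iff_unique_mem.2 ⟨hzero T hT ▸ hT, hzero⟩
  exact not_isOpen_singleton (0 : RealTensor n₁ n₂ n₃) (hU₀ ▸ hU)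

theorem isTypicalSubrank_iff (r : ℕ) : IsTypicalSubrank 2 2 2 r ↔ r = 1 ∨ r = 2 := by
  constructor
  · intro hr
    have hne : r ≠ 0 := fun h => not_isTypicalSubrank_zero (h ▸ hr)
    obtain ⟨U, -, ⟨T, hT⟩, hsub⟩ := hr
    have hle : r ≤ 2 := hsub hT ▸ subrank_le T
    omega
  · rintro (rfl | rfl)
    · exact ⟨{T | hyperdet T < 0}, isOpen_lt continuous_hyperdet continuous_const,
        ⟨![![![1, 0], ![0, 1]], ![![0, 1], ![-1, 0]]], by simp [hyperdet]⟩,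
        fun T hT => subrank_eq_one_of_hyperdet_neg hT⟩
    · exact ⟨{T | 0 < hyperdet T}, isOpen_lt continuous_const continuous_hyperdet,
        ⟨unit 2, by simp [hyperdet_unit]⟩, fun T hT => (subrank_eq_two_iff T).2 hT⟩

end Hyperdeterminant

end RealTensor

section UniformLaw

open Set

theorem measure_eq_of_Ioi_eq {μ ν : Measure ℝ} [IsProbabilityMeasure μ] [IsProbabilityMeasure ν]
    (h : ∀ c, μ (Ioi c) = ν (Ioi c)) : μ = ν :=
  Measure.ext_of_Iic _ _ fun c => by
    rw [← compl_Ioi, prob_compl_eq_one_sub measurableSet_Ioi,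
      prob_compl_eq_one_sub measurableSet_Ioi, h]

theorem cond_Icc_Ioi {a b c : ℝ} (hab : a < b) (hc : a ≤ c) :
    volume[|Icc a b] (Ioi c) = ENNReal.ofReal ((b - c) / (b - a)) := by
  have hinter : Icc a b ∩ Ioi c = Ioc c b := by
    ext x
    exact ⟨fun h => ⟨h.2, h.1.2⟩, fun h => ⟨⟨hc.trans h.1.le, h.2⟩, h.1⟩⟩
  rw [cond_apply measurableSet_Icc, hinter, Real.volume_Icc, Real.volume_Ioc,
    ENNReal.ofReal_div_of_pos (sub_pos.2 hab), ENNReal.div_eq_inv_mul]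

theorem measure_Ioi_eq_of_forall_mem_Icc {μ : Measure ℝ} [IsProbabilityMeasure μ] {a b : ℝ}
    (hab : a < b) (h : ∀ c ∈ Icc a b, μ (Ioi c) = ENNReal.ofReal ((b - c) / (b - a))) (c : ℝ) :
    μ (Ioi c) = ENNReal.ofReal ((b - max a (min c b)) / (b - a)) := by
  rcases lt_or_ge c a with hca | hac
  · have ha := h a (left_mem_Icc.2 hab.le)
    rw [div_self (sub_pos.2 hab).ne', ENNReal.ofReal_one] at ha
    rw [max_eq_left ((min_le_left _ _).trans hca.le), div_self (sub_pos.2 hab).ne',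
      ENNReal.ofReal_one]
    exact prob_le_one.antisymm (ha.ge.trans (measure_mono (Ioi_subset_Ioi hca.le)))
  · rcases le_total c b with hcb | hbc
    · rw [min_eq_left hcb, max_eq_right hac, h c ⟨hac, hcb⟩]
    · have hb := h b (right_mem_Icc.2 hab.le)
      rw [sub_self, zero_div, ENNReal.ofReal_zero] at hb
      rw [min_eq_right hbc, max_eq_right hab.le, sub_self, zero_div, ENNReal.ofReal_zero]
      exact measure_mono_null (Ioi_subset_Ioi hbc) hb

theorem eq_cond_Icc_of_measure_Ioi {μ : Measure ℝ} [IsProbabilityMeasure μ] {a b : ℝ}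
    (hab : a < b) (h : ∀ c ∈ Icc a b, μ (Ioi c) = ENNReal.ofReal ((b - c) / (b - a))) :
    μ = volume[|Icc a b] := by
  have : IsProbabilityMeasure (volume[|Icc a b]) :=
    cond_isProbabilityMeasure_of_finite (by simp [hab]) (by simp)
  refine measure_eq_of_Ioi_eq fun c => ?_
  rw [measure_Ioi_eq_of_forall_mem_Icc hab h,
    measure_Ioi_eq_of_forall_mem_Icc hab fun c hc => cond_Icc_Ioi hab hc.1]

theorem volume_sq_add_sq_lt_one :
    volume {p : ℝ × ℝ | p.1 ^ 2 + p.2 ^ 2 < 1} = ENNReal.ofReal Real.pi := by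
  have hdisc : Complex.measurableEquivRealProd ⁻¹' {p : ℝ × ℝ | p.1 ^ 2 + p.2 ^ 2 < 1} =
      Metric.ball (0 : ℂ) 1 := by
    ext z
    rw [mem_ball_zero_iff, ← sq_lt_one_iff₀ (norm_nonneg z), Complex.sq_norm,
      Complex.normSq_apply, ← sq, ← sq]
    rfl
  have hm : MeasurableSet {p : ℝ × ℝ | p.1 ^ 2 + p.2 ^ 2 < 1} :=
    measurableSet_lt (by fun_prop) (by fun_prop)
  rw [← Complex.volume_preserving_equiv_real_prod.measure_preimage hm.nullMeasurableSet, hdisc,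
    Complex.volume_ball, ENNReal.ofReal_one, one_pow, one_mul]
  exact congrArg _ (Real.toNNReal_of_nonneg Real.pi_pos.le).symm

theorem cond_Icc_prod_sq_add_sq_lt_one :
    (volume[|Icc (-1 : ℝ) 1]).prod (volume[|Icc (-1 : ℝ) 1]) {p | p.1 ^ 2 + p.2 ^ 2 < 1} =
      ENNReal.ofReal (Real.pi / 4) := by
  have hm : MeasurableSet {p : ℝ × ℝ | p.1 ^ 2 + p.2 ^ 2 < 1} :=
    measurableSet_lt (by fun_prop) (by fun_prop)
  have hsub : {p : ℝ × ℝ | p.1 ^ 2 + p.2 ^ 2 < 1} ⊆ Icc (-1) 1 ×ˢ Icc (-1) 1 := by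
    intro p (hp : p.1 ^ 2 + p.2 ^ 2 < 1)
    exact ⟨abs_le.1 ((sq_le_one_iff_abs_le_one _).1 (by nlinarith [sq_nonneg p.2])),
      abs_le.1 ((sq_le_one_iff_abs_le_one _).1 (by nlinarith [sq_nonneg p.1]))⟩
  have hvol : volume (Icc (-1 : ℝ) 1) = 2 := by
    rw [Real.volume_Icc]
    norm_num
  rw [ProbabilityTheory.cond, Measure.prod_smul_left, Measure.prod_smul_right,
    Measure.prod_restrict, ← Measure.volume_eq_prod, Measure.smul_apply, Measure.smul_apply,
    Measure.restrict_apply hm, inter_eq_left.2 hsub, volume_sq_add_sq_lt_one, hvol, smul_eq_mul,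
    smul_eq_mul, ← mul_assoc, ← ENNReal.mul_inv (by simp) (by simp),
    ENNReal.ofReal_div_of_pos (by norm_num), ENNReal.div_eq_inv_mul]
  norm_num

end UniformLaw

section ExponentialLaw

open Set
open scoped ENNReal

theorem expMeasure_Ioi {r t : ℝ} (hr : 0 < r) (ht : 0 ≤ t) :
    expMeasure r (Ioi t) = ENNReal.ofReal (Real.exp (-(r * t))) := by
  have := isProbabilityMeasure_expMeasure hr
  have hexp : Real.exp (-(r * t)) ≤ 1 := Real.exp_le_one_iff.2 (neg_nonpos.2 (by positivity))
  rw [← compl_Iic, prob_compl_eq_one_sub measurableSet_Iic, ← ofReal_cdf, cdf_expMeasure_eq hr,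
    if_pos ht, ← ENNReal.ofReal_one, ← ENNReal.ofReal_sub _ (sub_nonneg.2 hexp), sub_sub_cancel]

theorem ae_pos_expMeasure {r : ℝ} (hr : 0 < r) : ∀ᵐ x ∂expMeasure r, x ∈ Ioi 0 := by
  have := isProbabilityMeasure_expMeasure hr
  exact (mem_ae_iff_prob_eq_one measurableSet_Ioi).2 (by simp [expMeasure_Ioi hr le_rfl])

theorem lintegral_exp_neg_mul_expMeasure {r s : ℝ} (hr : 0 < r) (hs : 0 ≤ s) :
    ∫⁻ x, ENNReal.ofReal (Real.exp (-(s * x))) ∂expMeasure r = ENNReal.ofReal (r / (r + s)) := by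
  have hrs : 0 < r + s := by positivity
  have hdensity (x : ℝ) : exponentialPDF r x * ENNReal.ofReal (Real.exp (-(s * x))) =
      ENNReal.ofReal (r / (r + s)) * exponentialPDF (r + s) x := by
    rcases lt_or_ge x 0 with hx | hx
    · simp only [exponentialPDF_of_neg hx, zero_mul, mul_zero]
    · rw [exponentialPDF_of_nonneg hx, exponentialPDF_of_nonneg hx,
        ← ENNReal.ofReal_mul (by positivity), ← ENNReal.ofReal_mul (by positivity), mul_assoc,
        ← Real.exp_add, ← mul_assoc, div_mul_cancel₀ _ hrs.ne']
      ring_nf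
  calc ∫⁻ x, ENNReal.ofReal (Real.exp (-(s * x))) ∂expMeasure r
      = ∫⁻ x, exponentialPDF r x * ENNReal.ofReal (Real.exp (-(s * x))) :=
        lintegral_withDensity_eq_lintegral_mul _ (measurable_exponentialPDFReal r).ennreal_ofReal
          (by fun_prop)
    _ = ENNReal.ofReal (r / (r + s)) * ∫⁻ x, exponentialPDF (r + s) x := by
        simp only [hdensity]
        exact lintegral_const_mul _ (measurable_exponentialPDFReal _).ennreal_ofReal
    _ = ENNReal.ofReal (r / (r + s)) := by rw [lintegral_exponentialPDF_eq_one hrs, mul_one]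

theorem expMeasure_prod_mul_lt_mul {r p q : ℝ} (hr : 0 < r) (hp : 0 < p) (hq : 0 ≤ q) :
    (expMeasure r).prod (expMeasure r) {z | q * z.2 < p * z.1} =
      ENNReal.ofReal (p / (p + q)) := by
  have := isProbabilityMeasure_expMeasure hr
  have hset (y : ℝ) : (fun x => (x, y)) ⁻¹' {z : ℝ × ℝ | q * z.2 < p * z.1} =
      Ioi (q / p * y) := by
    ext x
    change q * y < p * x ↔ q / p * y < x
    rw [div_mul_eq_mul_div, div_lt_iff₀' hp]
  calc (expMeasure r).prod (expMeasure r) {z | q * z.2 < p * z.1}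
      = ∫⁻ y, expMeasure r (Ioi (q / p * y)) ∂expMeasure r := by
        rw [Measure.prod_apply_symm (measurableSet_lt (by fun_prop) (by fun_prop))]
        simp only [hset]
    _ = ∫⁻ y, ENNReal.ofReal (Real.exp (-(r * (q / p) * y))) ∂expMeasure r := by
        refine lintegral_congr_ae ?_
        filter_upwards [ae_pos_expMeasure hr] with y (hy : 0 < y)
        rw [expMeasure_Ioi hr (by positivity), ← mul_assoc]
    _ = ENNReal.ofReal (p / (p + q)) := by
        rw [lintegral_exp_neg_mul_expMeasure hr (by positivity)]
        congr 1
        field_simp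

theorem expMeasure_prod_lt_sub_div_add {r c : ℝ} (hr : 0 < r) (hc : c ∈ Icc (-1) 1) :
    (expMeasure r).prod (expMeasure r) {z | c < (z.1 - z.2) / (z.1 + z.2)} =
      ENNReal.ofReal ((1 - c) / 2) := by
  have := isProbabilityMeasure_expMeasure hr
  have hfst := Measure.quasiMeasurePreserving_fst (μ := expMeasure r) (ν := expMeasure r)
    |>.ae (ae_pos_expMeasure hr)
  have hsnd := Measure.quasiMeasurePreserving_snd (μ := expMeasure r) (ν := expMeasure r)
    |>.ae (ae_pos_expMeasure hr)
  rcases hc.2.eq_or_lt with rfl | hc1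
  · rw [sub_self, zero_div, ENNReal.ofReal_zero, measure_eq_zero_iff_ae_notMem]
    filter_upwards [hfst, hsnd] with z (hx : 0 < z.1) (hy : 0 < z.2)
      (h : 1 < (z.1 - z.2) / (z.1 + z.2))
    rw [one_lt_div (add_pos hx hy)] at h
    linarith
  · calc (expMeasure r).prod (expMeasure r) {z | c < (z.1 - z.2) / (z.1 + z.2)}
        = (expMeasure r).prod (expMeasure r) {z | (1 + c) * z.2 < (1 - c) * z.1} := by
          refine measure_congr (Filter.eventuallyEq_set.2 ?_)
          filter_upwards [hfst, hsnd] with z (hx : 0 < z.1) (hy : 0 < z.2)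
          rw [lt_div_iff₀ (add_pos hx hy)]
          constructor <;> intro h <;> linarith
      _ = ENNReal.ofReal ((1 - c) / 2) := by
          rw [expMeasure_prod_mul_lt_mul hr (sub_pos.2 hc1) (by linarith [hc.1])]
          ring_nf

theorem measurePreserving_sub_div_add_expMeasure {r : ℝ} (hr : 0 < r) :
    MeasurePreserving (fun z : ℝ × ℝ => (z.1 - z.2) / (z.1 + z.2))
      ((expMeasure r).prod (expMeasure r)) (volume[|Icc (-1 : ℝ) 1]) := by
  have := isProbabilityMeasure_expMeasure hr
  have hm : Measurable fun z : ℝ × ℝ => (z.1 - z.2) / (z.1 + z.2) := by fun_prop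
  have := Measure.isProbabilityMeasure_map (μ := (expMeasure r).prod (expMeasure r)) hm.aemeasurable
  refine ⟨hm, eq_cond_Icc_of_measure_Ioi (by norm_num) fun c hc => ?_⟩
  rw [Measure.map_apply hm measurableSet_Ioi, sub_neg_eq_add, one_add_one_eq_two]
  exact expMeasure_prod_lt_sub_div_add hr hc

end ExponentialLaw

section GaussianLaw

open Set
open scoped ENNReal

theorem gaussianPDF_mul_gaussianPDF_polarCoord_symm (r θ : ℝ) :
    gaussianPDF 0 1 (polarCoord.symm (r, θ)).1 * gaussianPDF 0 1 (polarCoord.symm (r, θ)).2 =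
      ENNReal.ofReal (Real.exp (-(r ^ 2 / 2)) / (2 * Real.pi)) := by
  have hsq : -(r * Real.cos θ) ^ 2 / 2 + -(r * Real.sin θ) ^ 2 / 2 = -(r ^ 2 / 2) := by
    linear_combination -(r ^ 2 / 2) * Real.sin_sq_add_cos_sq θ
  simp only [polarCoord_symm_apply, gaussianPDF]
  rw [← ENNReal.ofReal_mul (gaussianPDFReal_nonneg _ _ _)]
  simp only [gaussianPDFReal, sub_zero, NNReal.coe_one, mul_one]
  rw [mul_mul_mul_comm, ← Real.exp_add, hsq, ← mul_inv, Real.mul_self_sqrt (by positivity),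
    inv_mul_eq_div]

theorem lintegral_sq_add_sq_gaussianReal_prod {g : ℝ → ℝ≥0∞} (hg : Measurable g) :
    ∫⁻ p, g (p.1 ^ 2 + p.2 ^ 2) ∂((gaussianReal 0 1).prod (gaussianReal 0 1)) =
      ∫⁻ r in Ioi 0, ENNReal.ofReal (r * Real.exp (-(r ^ 2 / 2))) * g (r ^ 2) := by
  have hpdf : Measurable (gaussianPDF 0 1) := measurable_gaussianPDF 0 1
  rw [gaussianReal_of_var_ne_zero 0 one_ne_zero, prod_withDensity hpdf hpdf,
    ← Measure.volume_eq_prod, lintegral_withDensity_eq_lintegral_mul _ (by fun_prop) (by fun_prop),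
    ← lintegral_comp_polarCoord_symm, polarCoord_target, Measure.volume_eq_prod,
    ← Measure.prod_restrict, lintegral_prod _ (by fun_prop)]
  refine setLIntegral_congr_fun measurableSet_Ioi fun r (hr : 0 < r) => ?_
  have hintegrand (θ : ℝ) : ENNReal.ofReal r • ((fun p : ℝ × ℝ =>
      gaussianPDF 0 1 p.1 * gaussianPDF 0 1 p.2) * fun p : ℝ × ℝ => g (p.1 ^ 2 + p.2 ^ 2))
        (polarCoord.symm (r, θ)) =
      ENNReal.ofReal (r * (Real.exp (-(r ^ 2 / 2)) / (2 * Real.pi))) * g (r ^ 2) := by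
    have hsq : (polarCoord.symm (r, θ)).1 ^ 2 + (polarCoord.symm (r, θ)).2 ^ 2 = r ^ 2 := by
      rw [polarCoord_symm_apply]
      linear_combination r ^ 2 * Real.sin_sq_add_cos_sq θ
    rw [Pi.mul_apply, hsq, gaussianPDF_mul_gaussianPDF_polarCoord_symm, smul_eq_mul, ← mul_assoc,
      ← ENNReal.ofReal_mul hr.le]
  simp only [hintegrand]
  rw [setLIntegral_const, Real.volume_Ioo, mul_right_comm, ← ENNReal.ofReal_mul (by positivity)]
  congr 2
  field_simp
  ring

theorem lintegral_expMeasure_half {g : ℝ → ℝ≥0∞} (hg : Measurable g) :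
    ∫⁻ x, g x ∂expMeasure (1 / 2) =
      ∫⁻ r in Ioi 0, ENNReal.ofReal (r * Real.exp (-(r ^ 2 / 2))) * g (r ^ 2) := by
  have himage : (fun r : ℝ => r ^ 2) '' Ioi 0 = Ioi 0 := by
    ext x
    exact ⟨fun ⟨r, hr, hx⟩ => hx ▸ pow_pos (mem_Ioi.1 hr) 2,
      fun hx => ⟨√x, Real.sqrt_pos.2 hx, Real.sq_sqrt (le_of_lt hx)⟩⟩
  have hderiv : ∀ r ∈ Ioi (0 : ℝ), HasDerivWithinAt (fun r : ℝ => r ^ 2) (2 * r) (Ioi 0) r :=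
    fun r _ => by simpa using (hasDerivAt_pow 2 r).hasDerivWithinAt
  have hinj : InjOn (fun r : ℝ => r ^ 2) (Ioi 0) := fun r hr s hs h =>
    (pow_left_inj₀ (le_of_lt hr) (le_of_lt hs) two_ne_zero).1 h
  calc ∫⁻ x, g x ∂expMeasure (1 / 2)
      = ∫⁻ x in Ioi 0, g x ∂expMeasure (1 / 2) := by
        rw [Measure.restrict_eq_self_of_ae_mem (ae_pos_expMeasure (by norm_num))]
    _ = ∫⁻ x in Ioi 0, exponentialPDF (1 / 2) x * g x :=
        setLIntegral_withDensity_eq_setLIntegral_mul _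
          (measurable_exponentialPDFReal _).ennreal_ofReal hg measurableSet_Ioi
    _ = ∫⁻ r in Ioi 0,
          ENNReal.ofReal |2 * r| * (exponentialPDF (1 / 2) (r ^ 2) * g (r ^ 2)) := by
        conv_lhs => rw [← himage]
        exact lintegral_image_eq_lintegral_abs_deriv_mul measurableSet_Ioi hderiv hinj _
    _ = _ := by
        refine setLIntegral_congr_fun measurableSet_Ioi fun r (hr : 0 < r) => ?_
        rw [← mul_assoc, exponentialPDF_of_nonneg (by positivity), abs_of_pos (by positivity),
          ← ENNReal.ofReal_mul (by positivity)]
        ring_nf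

theorem measurePreserving_sq_add_sq_gaussianReal :
    MeasurePreserving (fun p : ℝ × ℝ => p.1 ^ 2 + p.2 ^ 2)
      ((gaussianReal 0 1).prod (gaussianReal 0 1)) (expMeasure (1 / 2)) := by
  have hm : Measurable fun p : ℝ × ℝ => p.1 ^ 2 + p.2 ^ 2 := by fun_prop
  refine ⟨hm, Measure.ext_of_lintegral _ fun g hg => ?_⟩
  rw [lintegral_map hg hm, lintegral_sq_add_sq_gaussianReal_prod hg, lintegral_expMeasure_half hg]

end GaussianLaw

section QuaternionGaussian

open Quaternion Set
open scoped Quaternion RealInnerProductSpace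

noncomputable instance : MeasurableSpace ℍ[ℝ] := borel _

instance : BorelSpace ℍ[ℝ] := ⟨rfl⟩

theorem measurable_quaternion_mk {α : Type*} [MeasurableSpace α] {f : Fin 4 → α → ℝ}
    (hf : ∀ i, Measurable (f i)) :
    Measurable (β := ℍ[ℝ]) fun a => ⟨f 0 a, f 1 a, f 2 a, f 3 a⟩ := by
  have hcont : Continuous linearIsometryEquivTuple.symm := linearIsometryEquivTuple.symm.continuous
  have htoLp : Measurable (WithLp.toLp 2 : (Fin 4 → ℝ) → EuclideanSpace ℝ (Fin 4)) := by fun_prop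
  exact (hcont.measurable.comp htoLp).comp (measurable_pi_lambda _ hf)

section Coordinates

variable {Ω : Type*} [MeasurableSpace Ω] {P : Measure Ω} {X : Fin 4 → Ω → ℝ}

theorem hasLaw_quaternion_stdGaussian (hX : ∀ i, HasLaw (X i) (gaussianReal 0 1) P)
    (hind : iIndepFun X P) :
    HasLaw (fun ω => (⟨X 0 ω, X 1 ω, X 2 ω, X 3 ω⟩ : ℍ[ℝ])) (stdGaussian ℍ[ℝ]) P := by
  have htoLp : MeasurePreserving (WithLp.toLp 2) (Measure.pi fun _ : Fin 4 => gaussianReal 0 1)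
      (stdGaussian (EuclideanSpace ℝ (Fin 4))) := ⟨by fun_prop, map_pi_eq_stdGaussian⟩
  have hequiv : MeasurePreserving linearIsometryEquivTuple.symm
      (stdGaussian (EuclideanSpace ℝ (Fin 4))) (stdGaussian ℍ[ℝ]) :=
    ⟨linearIsometryEquivTuple.symm.continuous.measurable, stdGaussian_map _⟩
  exact (hequiv.comp htoLp).comp_hasLaw (hind.hasLaw_pi hX)

theorem hasLaw_sq_add_sq_sub_div_uniform (hX : ∀ i, HasLaw (X i) (gaussianReal 0 1) P)
    (hind : iIndepFun X P) :
    HasLaw (fun ω => (X 0 ω ^ 2 + X 1 ω ^ 2 - (X 2 ω ^ 2 + X 3 ω ^ 2)) /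
      (X 0 ω ^ 2 + X 1 ω ^ 2 + (X 2 ω ^ 2 + X 3 ω ^ 2))) (volume[|Icc (-1 : ℝ) 1]) P := by
  have : IsProbabilityMeasure P := (hX 0).isProbabilityMeasure
  have := isProbabilityMeasure_expMeasure one_half_pos
  have hpair {i j : Fin 4} (hij : i ≠ j) :
      HasLaw (fun ω => (X i ω, X j ω)) ((gaussianReal 0 1).prod (gaussianReal 0 1)) P :=
    (hind.indepFun hij).hasLaw_prod (hX i) (hX j)
  have hpairs := (hind.indepFun_prodMk_prodMk₀ (fun i => (hX i).aemeasurable) 0 1 2 3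
    (by decide) (by decide) (by decide) (by decide)).hasLaw_prod
      (hpair (by decide)) (hpair (by decide))
  exact ((measurePreserving_sub_div_add_expMeasure one_half_pos).comp
    (measurePreserving_sq_add_sq_gaussianReal.prod
      measurePreserving_sq_add_sq_gaussianReal)).comp_hasLaw hpairs

end Coordinates

theorem ae_inner_ne_zero_stdGaussian {E : Type*} [NormedAddCommGroup E] [InnerProductSpace ℝ E]
    [FiniteDimensional ℝ E] [MeasurableSpace E] [BorelSpace E] {v : E} (hv : v ≠ 0) :
    ∀ᵐ x ∂stdGaussian E, ⟪v, x⟫ ≠ 0 := by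
  have hlaw : HasLaw (innerSL ℝ v) (gaussianReal 0 (‖v‖₊ ^ 2)) (stdGaussian E) := by
    refine ⟨by fun_prop, ?_⟩
    rw [IsGaussian.map_eq_gaussianReal, integral_strongDual_stdGaussian, variance_dual_stdGaussian,
      innerSL_apply_norm]
    congr 1
    ext
    simp
  have hatom : ∀ᵐ y ∂gaussianReal 0 (‖v‖₊ ^ 2), y ≠ 0 :=
    (gaussianReal_absolutelyContinuous 0 (by simpa using hv)).ae_le (Measure.ae_ne volume 0)
  exact (hlaw.ae_iff (p := (· ≠ 0)) (by fun_prop)).2 hatom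

theorem ae_ne_zero_stdGaussian {E : Type*} [NormedAddCommGroup E] [InnerProductSpace ℝ E]
    [FiniteDimensional ℝ E] [Nontrivial E] [MeasurableSpace E] [BorelSpace E] :
    ∀ᵐ x ∂stdGaussian E, x ≠ 0 := by
  obtain ⟨v, hv⟩ := exists_ne (0 : E)
  filter_upwards [ae_inner_ne_zero_stdGaussian hv] with x hx h0
  exact hx (by rw [h0, inner_zero_right])

theorem measurePreserving_mul_mul_stdGaussian {a b : ℍ[ℝ]} (ha : ‖a‖ = 1) (hb : ‖b‖ = 1) :
    MeasurePreserving (fun x : ℍ[ℝ] => a * x * b) (stdGaussian ℍ[ℝ]) (stdGaussian ℍ[ℝ]) := by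
  let f : ℍ[ℝ] →ₗᵢ[ℝ] ℍ[ℝ] :=
    ⟨LinearMap.mulLeftRight ℝ (a, b), fun x => by simp [ha, hb]⟩
  exact ⟨by fun_prop, stdGaussian_map (f.toLinearIsometryEquiv rfl)⟩

end QuaternionGaussian

section QuaternionPencil

open InnerProductGeometry Quaternion
open scoped Quaternion RealInnerProductSpace

/-- The quaternion unit `i`. -/
@[simps] def quaternionI : ℍ[ℝ] := ⟨0, 1, 0, 0⟩

/-- The quaternion unit `j`. -/
@[simps] def quaternionJ : ℍ[ℝ] := ⟨0, 0, 1, 0⟩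

theorem norm_quaternionI : ‖quaternionI‖ = 1 := by
  rw [← sq_eq_sq₀ (norm_nonneg _) zero_le_one, sq, ← normSq_eq_norm_mul_self, normSq_def']
  simp

theorem norm_quaternionJ : ‖quaternionJ‖ = 1 := by
  rw [← sq_eq_sq₀ (norm_nonneg _) zero_le_one, sq, ← normSq_eq_norm_mul_self, normSq_def']
  simp

theorem exists_norm_eq_one_mul_eq_smul {e : ℍ[ℝ]} (he : e.re = 0) :
    ∃ a : ℍ[ℝ], ‖a‖ = 1 ∧ a * e = ‖e‖ • (quaternionI * a) := by
  have hsq : ‖e‖ ^ 2 = e.imI ^ 2 + e.imJ ^ 2 + e.imK ^ 2 := by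
    rw [sq, ← normSq_eq_norm_mul_self, normSq_def', he]
    ring
  by_cases h : ‖e‖ • quaternionI + e = 0
  · refine ⟨quaternionJ, norm_quaternionJ, ?_⟩
    rw [eq_neg_of_add_eq_zero_right h, norm_neg, norm_smul, norm_norm, norm_quaternionI, mul_one]
    ext <;> simp
  · refine ⟨‖‖e‖ • quaternionI + e‖⁻¹ • (‖e‖ • quaternionI + e), norm_smul_inv_norm h, ?_⟩
    rw [smul_mul_assoc, mul_smul_comm, smul_comm]
    congr 1
    ext <;> simp only [re_mul, imI_mul, imJ_mul, imK_mul, re_add, imI_add, imJ_add, imK_add,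
      re_smul, imI_smul, imJ_smul, imK_smul, smul_eq_mul, he, re_quaternionI,
      imI_quaternionI, imJ_quaternionI, imK_quaternionI] <;> linarith

theorem angle_mul_mul {a b : ℍ[ℝ]} (ha : ‖a‖ = 1) (hb : ‖b‖ = 1) (x y : ℍ[ℝ]) :
    angle (a * x * b) (a * y * b) = angle x y :=
  (⟨LinearMap.mulLeftRight ℝ (a, b), fun x => by simp [ha, hb]⟩ : ℍ[ℝ] →ₗᵢ[ℝ] ℍ[ℝ]).angle_map x y

/-- The discriminant of the pencil spanned by the real `2 × 2` matrices whose entries, row by row,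
are the coordinates of the quaternions `α` and `β`. -/
noncomputable def pencilDisc (α β : ℍ[ℝ]) : ℝ :=
  ‖(α * star β).im‖ ^ 2 - (α * star β).imI ^ 2 - (star α * β).imJ ^ 2

theorem im_mul_mul_star (l p : ℍ[ℝ]) : (l * p * star l).im = l * p.im * star l := by
  ext <;> simp only [re_im, imI_im, imJ_im, imK_im, re_mul, imI_mul, imJ_mul, imK_mul,
    re_star, imI_star, imJ_star, imK_star] <;> ring

theorem imI_mul_mul_star (l p : ℍ[ℝ]) :
    (l * p * star l).imI = ⟪quaternionI * l, l * p.im⟫ := by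
  simp only [inner_def, re_mul, imI_mul, imJ_mul, imK_mul, re_star, imI_star, imJ_star, imK_star,
    re_im, imI_im, imJ_im, imK_im, re_quaternionI, imI_quaternionI, imJ_quaternionI,
    imK_quaternionI]
  ring

theorem imJ_star_mul_mul (r p : ℍ[ℝ]) :
    (star r * p * r).imJ = ⟪p.im * r, r * quaternionJ⟫ := by
  simp only [inner_def, re_mul, imI_mul, imJ_mul, imK_mul, re_star, imI_star, imJ_star, imK_star,
    re_im, imI_im, imJ_im, imK_im, re_quaternionJ, imI_quaternionJ, imJ_quaternionJ,
    imK_quaternionJ]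
  ring

theorem norm_im_star_mul (α β : ℍ[ℝ]) : ‖(star α * β).im‖ = ‖(α * star β).im‖ := by
  rw [← sq_eq_sq₀ (norm_nonneg _) (norm_nonneg _), sq, sq, ← normSq_eq_norm_mul_self,
    ← normSq_eq_norm_mul_self, normSq_def', normSq_def']
  simp only [re_im, imI_im, imJ_im, imK_im, imI_mul, imJ_mul, imK_mul,
    re_star, imI_star, imJ_star, imK_star]
  ring

theorem mul_mul_mul_star (l r α β : ℍ[ℝ]) :
    l * α * r * star (l * β * r) = normSq r • (l * (α * star β) * star l) := by
  calc l * α * r * star (l * β * r) = l * α * (r * star r) * star β * star l := by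
        simp only [star_mul, mul_assoc]
    _ = normSq r • (l * (α * star β) * star l) := by
        rw [self_mul_star, ← coe_commutes]
        simp only [← coe_mul_eq_smul, mul_assoc]

theorem star_mul_mul_mul (l r α β : ℍ[ℝ]) :
    star (l * α * r) * (l * β * r) = normSq l • (star r * (star α * β) * r) := by
  calc star (l * α * r) * (l * β * r) = star r * star α * (star l * l) * β * r := by
        simp only [star_mul, mul_assoc]
    _ = normSq l • (star r * (star α * β) * r) := by
        rw [star_mul_self, ← coe_commutes]
        simp only [← coe_mul_eq_smul, mul_assoc]

theorem pencilDisc_mul_mul (l r α β : ℍ[ℝ]) :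
    pencilDisc (l * α * r) (l * β * r) = (‖l‖ * ‖r‖) ^ 4 * ‖(α * star β).im‖ ^ 2 *
      (1 - Real.cos (angle (quaternionI * l) (l * (α * star β).im)) ^ 2
        - Real.cos (angle ((star α * β).im * r) (r * quaternionJ)) ^ 2) := by
  rw [pencilDisc, mul_mul_mul_star, star_mul_mul_mul, im_smul, imI_smul, imJ_smul,
    im_mul_mul_star, imI_mul_mul_star, imJ_star_mul_mul, ← cos_angle_mul_norm_mul_norm,
    ← cos_angle_mul_norm_mul_norm]
  simp only [norm_smul, norm_mul, norm_star, norm_quaternionI, norm_quaternionJ, norm_im_star_mul,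
    normSq_eq_norm_mul_self, norm_norm, smul_eq_mul]
  ring

theorem pencilDisc_smul (c : ℝ) (α β : ℍ[ℝ]) :
    pencilDisc (c • α) (c • β) = c ^ 4 * pencilDisc α β := by
  simp only [pencilDisc, Quaternion.star_smul, smul_mul_smul_comm, im_smul, imI_smul, imJ_smul,
    norm_smul, Real.norm_eq_abs, mul_pow, sq_abs, smul_eq_mul]
  ring

theorem continuous_pencilDisc : Continuous fun p : ℍ[ℝ] × ℍ[ℝ] => pencilDisc p.1 p.2 := by
  have := continuous_im
  have := continuous_imI
  have := continuous_imJ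
  unfold pencilDisc
  fun_prop

end QuaternionPencil

namespace RealTensor

open Quaternion
open scoped Quaternion

/-- The `i`-th slice `(T i j k)_{j, k}` of a `2 × 2 × 2` tensor, its entries read row by row as the
coordinates of a quaternion. -/
@[simps] def slice (T : RealTensor 2 2 2) (i : Fin 2) : ℍ[ℝ] := ⟨T i 0 0, T i 0 1, T i 1 0, T i 1 1⟩

theorem hyperdet_eq_pencilDisc (T : RealTensor 2 2 2) :
    hyperdet T = pencilDisc (slice T 0) (slice T 1) := by
  rw [pencilDisc, sq ‖_‖, ← normSq_eq_norm_mul_self, normSq_def', hyperdet]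
  simp only [re_im, imI_im, imJ_im, imK_im, imI_mul, imJ_mul, imK_mul,
    re_star, imI_star, imJ_star, imK_star, re_slice, imI_slice, imJ_slice, imK_slice]
  ring

end RealTensor

section QuaternionProbability

open InnerProductGeometry Quaternion Set
open scoped Quaternion RealInnerProductSpace

theorem cos_angle_quaternionI_mul (x : ℍ[ℝ]) :
    Real.cos (angle (quaternionI * x) (x * quaternionI)) =
      (x.re ^ 2 + x.imI ^ 2 - (x.imJ ^ 2 + x.imK ^ 2)) /
        (x.re ^ 2 + x.imI ^ 2 + (x.imJ ^ 2 + x.imK ^ 2)) := by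
  rw [cos_angle, norm_mul, norm_mul, norm_quaternionI, one_mul, mul_one, ← normSq_eq_norm_mul_self,
    normSq_def', inner_def]
  congr 1
  · simp only [re_mul, imI_mul, imJ_mul, imK_mul, re_star, imI_star, imJ_star, imK_star,
      re_quaternionI, imI_quaternionI, imJ_quaternionI,
      imK_quaternionI]
    ring
  · ring

theorem measurable_cos_angle_mul (e u : ℍ[ℝ]) :
    Measurable fun x : ℍ[ℝ] => Real.cos (angle (e * x) (x * u)) := by
  simp only [cos_angle]
  fun_prop

theorem hasLaw_cos_angle_quaternionI_mul :
    HasLaw (fun x : ℍ[ℝ] => Real.cos (angle (quaternionI * x) (x * quaternionI)))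
      (volume[|Icc (-1 : ℝ) 1]) (stdGaussian ℍ[ℝ]) := by
  let P := Measure.pi fun _ : Fin 4 => gaussianReal 0 1
  have hX (i : Fin 4) : HasLaw (fun ω : Fin 4 → ℝ => ω i) (gaussianReal 0 1) P :=
    (measurePreserving_eval (fun _ => gaussianReal 0 1) i).hasLaw
  have hind : iIndepFun (fun (i : Fin 4) (ω : Fin 4 → ℝ) => ω i) P :=
    iIndepFun_pi (X := fun _ => id) fun _ => aemeasurable_id
  refine HasLaw.comp_of_hasLaw_comp
    (f := fun x : ℍ[ℝ] => Real.cos (angle (quaternionI * x) (x * quaternionI)))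
    (measurable_cos_angle_mul quaternionI quaternionI).aemeasurable
    (hasLaw_quaternion_stdGaussian hX hind) .id ?_
  exact (hasLaw_sq_add_sq_sub_div_uniform hX hind).congr
    (.of_forall fun ω => cos_angle_quaternionI_mul _)

theorem measurePreserving_cos_angle_mul {e u : ℍ[ℝ]} (he : e.re = 0) (hu : u.re = 0)
    (he0 : e ≠ 0) (hu0 : u ≠ 0) :
    MeasurePreserving (fun x : ℍ[ℝ] => Real.cos (angle (e * x) (x * u))) (stdGaussian ℍ[ℝ])
      (volume[|Icc (-1 : ℝ) 1]) := by
  obtain ⟨a, ha, hae⟩ := exists_norm_eq_one_mul_eq_smul he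
  obtain ⟨b, hb, hbu⟩ := exists_norm_eq_one_mul_eq_smul hu
  have hub : u * star b = ‖u‖ • (star b * quaternionI) := by
    have hI : star quaternionI = -quaternionI := star_eq_neg.2 re_quaternionI
    simpa [star_eq_neg.2 hu, hI] using congrArg star hbu
  have hconj (x : ℍ[ℝ]) : angle (e * x) (x * u) =
      angle (quaternionI * (a * x * star b)) (a * x * star b * quaternionI) := by
    rw [← angle_mul_mul ha ((_root_.norm_star b).trans hb)]
    calc angle (a * (e * x) * star b) (a * (x * u) * star b)
        = angle (a * e * x * star b) (a * x * (u * star b)) := by simp only [mul_assoc]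
      _ = angle (‖e‖ • (quaternionI * (a * x * star b)))
            (‖u‖ • (a * x * star b * quaternionI)) := by
          simp only [hae, hub, smul_mul_assoc, mul_smul_comm, mul_assoc]
      _ = _ := by
          rw [angle_smul_left_of_pos _ _ (norm_pos_iff.2 he0),
            angle_smul_right_of_pos _ _ (norm_pos_iff.2 hu0)]
  simp only [hconj]
  exact (hasLaw_cos_angle_quaternionI_mul.measurePreserving (measurable_cos_angle_mul _ _)).comp
    (measurePreserving_mul_mul_stdGaussian ha ((_root_.norm_star b).trans hb))

theorem measurableSet_pencilDisc_pos : MeasurableSet {p : ℍ[ℝ] × ℍ[ℝ] | 0 < pencilDisc p.1 p.2} :=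
  (isOpen_lt continuous_const continuous_pencilDisc).measurableSet

theorem ae_im_mul_star_ne_zero : ∀ᵐ p ∂(stdGaussian ℍ[ℝ]).prod (stdGaussian ℍ[ℝ]),
    (p.1 * star p.2).im ≠ 0 := by
  have hopen : IsOpen {p : ℍ[ℝ] × ℍ[ℝ] | (p.1 * star p.2).im ≠ 0} :=
    isOpen_ne_fun (continuous_im.comp (by fun_prop)) continuous_const
  rw [Measure.ae_prod_iff_ae_ae hopen.measurableSet]
  filter_upwards [ae_ne_zero_stdGaussian] with α hα
  have hIα : quaternionI * α ≠ 0 := mul_ne_zero (by simp [← norm_ne_zero_iff, norm_quaternionI]) hα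
  filter_upwards [ae_inner_ne_zero_stdGaussian hIα] with β hβ him
  refine hβ ?_
  have hinner : ⟪quaternionI * α, β⟫ = -(α * star β).imI := by
    simp only [inner_def, re_mul, imI_mul, imJ_mul, imK_mul, re_star, imI_star, imJ_star, imK_star,
      re_quaternionI, imI_quaternionI, imJ_quaternionI,
      imK_quaternionI]
    ring
  rw [hinner, ← imI_im, him, imI_zero, neg_zero]

theorem measure_pencilDisc_mul_mul_pos {α β : ℍ[ℝ]} (h : (α * star β).im ≠ 0) :
    (stdGaussian ℍ[ℝ]).prod (stdGaussian ℍ[ℝ])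
      {p | 0 < pencilDisc (p.1 * α * p.2) (p.1 * β * p.2)} = ENNReal.ofReal (Real.pi / 4) := by
  have hpos : 0 < ‖(α * star β).im‖ := norm_pos_iff.2 h
  have h' : (star α * β).im ≠ 0 := norm_pos_iff.1 ((norm_im_star_mul α β).symm ▸ hpos)
  have hI : quaternionI ≠ 0 := norm_ne_zero_iff.1 (by simp [norm_quaternionI])
  have hJ : quaternionJ ≠ 0 := norm_ne_zero_iff.1 (by simp [norm_quaternionJ])
  have hcos := (measurePreserving_cos_angle_mul re_quaternionI (re_im _) hI h).prod
    (measurePreserving_cos_angle_mul (re_im _) re_quaternionJ h' hJ)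
  have hdisc : MeasurableSet {p : ℝ × ℝ | p.1 ^ 2 + p.2 ^ 2 < 1} :=
    measurableSet_lt (by fun_prop) (by fun_prop)
  rw [← cond_Icc_prod_sq_add_sq_lt_one, ← hcos.measure_preimage hdisc.nullMeasurableSet]
  refine measure_congr (Filter.eventuallyEq_set.2 ?_)
  filter_upwards [Measure.quasiMeasurePreserving_fst.ae ae_ne_zero_stdGaussian,
    Measure.quasiMeasurePreserving_snd.ae ae_ne_zero_stdGaussian] with p hl hr
  have hc : 0 < (‖p.1‖ * ‖p.2‖) ^ 4 * ‖(α * star β).im‖ ^ 2 := by positivity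
  simp only [mem_preimage, mem_ofPred_eq, Prod.map_fst, Prod.map_snd]
  rw [pencilDisc_mul_mul, mul_pos_iff_of_pos_left hc, sub_sub, sub_pos]

theorem measure_mul_mul_pencilDisc_pos {l r : ℍ[ℝ]} (hl : l ≠ 0) (hr : r ≠ 0) :
    (stdGaussian ℍ[ℝ]).prod (stdGaussian ℍ[ℝ])
      {p | 0 < pencilDisc (l * p.1 * r) (l * p.2 * r)} =
    (stdGaussian ℍ[ℝ]).prod (stdGaussian ℍ[ℝ]) {p | 0 < pencilDisc p.1 p.2} := by
  have hrot := measurePreserving_mul_mul_stdGaussian (norm_smul_inv_norm (𝕜 := ℝ) hl)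
    (norm_smul_inv_norm (𝕜 := ℝ) hr)
  rw [← (hrot.prod hrot).measure_preimage measurableSet_pencilDisc_pos.nullMeasurableSet]
  congr 1
  ext p
  have hc : 0 < (‖r‖⁻¹ * ‖l‖⁻¹) ^ 4 := by positivity
  simp only [mem_preimage, mem_ofPred_eq, Prod.map_fst, Prod.map_snd, smul_mul_assoc,
    mul_smul_comm, smul_smul, RCLike.ofReal_real_eq_id, id_eq]
  rw [pencilDisc_smul, mul_pos_iff_of_pos_left hc]

theorem measure_pencilDisc_pos :
    (stdGaussian ℍ[ℝ]).prod (stdGaussian ℍ[ℝ]) {p | 0 < pencilDisc p.1 p.2} =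
      ENNReal.ofReal (Real.pi / 4) := by
  let μ := (stdGaussian ℍ[ℝ]).prod (stdGaussian ℍ[ℝ])
  let S : Set ((ℍ[ℝ] × ℍ[ℝ]) × (ℍ[ℝ] × ℍ[ℝ])) :=
    {q | 0 < pencilDisc (q.1.1 * q.2.1 * q.1.2) (q.1.1 * q.2.2 * q.1.2)}
  have hS : MeasurableSet S :=
    (isOpen_lt continuous_const (continuous_pencilDisc.comp
      (by fun_prop : Continuous fun q : (ℍ[ℝ] × ℍ[ℝ]) × (ℍ[ℝ] × ℍ[ℝ]) =>
        (q.1.1 * q.2.1 * q.1.2, q.1.1 * q.2.2 * q.1.2)))).measurableSet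
  calc μ {p | 0 < pencilDisc p.1 p.2} = ∫⁻ _, μ {p | 0 < pencilDisc p.1 p.2} ∂μ := by simp
    _ = μ.prod μ S := by
      rw [Measure.prod_apply hS]
      refine lintegral_congr_ae ?_
      filter_upwards [Measure.quasiMeasurePreserving_fst.ae ae_ne_zero_stdGaussian,
        Measure.quasiMeasurePreserving_snd.ae ae_ne_zero_stdGaussian] with q hl hr
      exact (measure_mul_mul_pencilDisc_pos hl hr).symm
    _ = ∫⁻ _, ENNReal.ofReal (Real.pi / 4) ∂μ := by
      rw [Measure.prod_apply_symm hS]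
      refine lintegral_congr_ae ?_
      filter_upwards [ae_im_mul_star_ne_zero] with p hp
      simpa only [S, preimage_ofPred_eq] using measure_pencilDisc_mul_mul_pos hp
    _ = ENNReal.ofReal (Real.pi / 4) := by simp

end QuaternionProbability

namespace RealTensor

open Quaternion Set
open scoped Quaternion

variable {Ω : Type*} [MeasurableSpace Ω] {P : Measure Ω} {t : Fin 2 → Fin 2 → Fin 2 → Ω → ℝ}

theorem indepFun_slice (ht : ∀ i j k, AEMeasurable (t i j k) P)
    (hind : iIndepFun (fun p : Fin 2 × Fin 2 × Fin 2 => t p.1 p.2.1 p.2.2) P) :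
    IndepFun (fun ω => slice (fun i j k => t i j k ω) 0)
      (fun ω => slice (fun i j k => t i j k ω) 1) P := by
  let σ (i : Fin 2) : Finset (Fin 2 × Fin 2 × Fin 2) := {p | p.1 = i}
  let entry (i : Fin 2) (m : Fin 4) (y : σ i → ℝ) : ℝ :=
    y ⟨(i, finProdFinEquiv.symm m), by simp [σ]⟩
  have hentry (i : Fin 2) := measurable_quaternion_mk (f := entry i) fun m => by fun_prop
  exact (hind.indepFun_finset₀ (σ 0) (σ 1) (by decide) fun p => ht p.1 p.2.1 p.2.2).comp
    (hentry 0) (hentry 1)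

theorem hasLaw_slice_stdGaussian (ht : ∀ i j k, HasLaw (t i j k) (gaussianReal 0 1) P)
    (hind : iIndepFun (fun p : Fin 2 × Fin 2 × Fin 2 => t p.1 p.2.1 p.2.2) P) (i : Fin 2) :
    HasLaw (fun ω => slice (fun i j k => t i j k ω) i) (stdGaussian ℍ[ℝ]) P := by
  let entry (m : Fin 4) : Fin 2 × Fin 2 × Fin 2 := (i, finProdFinEquiv.symm m)
  have hentry : entry.Injective := fun m n h => finProdFinEquiv.symm.injective (Prod.ext_iff.1 h).2
  exact hasLaw_quaternion_stdGaussian (fun m => ht (entry m).1 (entry m).2.1 (entry m).2.2)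
    (hind.precomp hentry)

theorem measure_hyperdet_pos {v : ℝ≥0} (hv : v ≠ 0)
    (ht : ∀ i j k, HasLaw (t i j k) (gaussianReal 0 v) P)
    (hind : iIndepFun (fun p : Fin 2 × Fin 2 × Fin 2 => t p.1 p.2.1 p.2.2) P) :
    P {ω | 0 < hyperdet (fun i j k => t i j k ω)} = ENNReal.ofReal (Real.pi / 4) := by
  have : IsProbabilityMeasure P := (ht 0 0 0).isProbabilityMeasure
  let c : ℝ := (√v)⁻¹
  have hcv : NNReal.mk (c ^ 2) (sq_nonneg c) * v = 1 := by
    ext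
    simp [c, inv_pow, hv]
  have hlaw (i j k : Fin 2) : HasLaw (fun ω => c * t i j k ω) (gaussianReal 0 1) P := by
    simpa only [mul_zero, hcv] using gaussianReal_const_mul (ht i j k) c
  have hindc : iIndepFun (fun (p : Fin 2 × Fin 2 × Fin 2) ω => c * t p.1 p.2.1 p.2.2 ω) P :=
    hind.comp (fun _ y => c * y) fun _ => by fun_prop
  have hslices := (indepFun_slice (fun i j k => (hlaw i j k).aemeasurable) hindc).hasLaw_prod
    (hasLaw_slice_stdGaussian hlaw hindc 0) (hasLaw_slice_stdGaussian hlaw hindc 1)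
  rw [← measure_pencilDisc_pos, ← hslices.measure_eq measurableSet_pencilDisc_pos]
  congr 1
  ext ω
  have hc : 0 < c ^ 4 := by
    have := pos_iff_ne_zero.2 hv
    positivity
  have hsmul (i : Fin 2) : slice (fun i j k => c * t i j k ω) i =
      c • slice (fun i j k => t i j k ω) i := by ext <;> simp
  simp only [mem_ofPred_eq, hyperdet_eq_pencilDisc, hsmul, pencilDisc_smul]
  rw [mul_pos_iff_of_pos_left hc]

theorem measure_subrank_eq_two {v : ℝ≥0} (hv : v ≠ 0)
    (ht : ∀ i j k, HasLaw (t i j k) (gaussianReal 0 v) P)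
    (hind : iIndepFun (fun p : Fin 2 × Fin 2 × Fin 2 => t p.1 p.2.1 p.2.2) P) :
    P {ω | subrank (fun i j k => t i j k ω) = 2} = ENNReal.ofReal (Real.pi / 4) := by
  simp only [subrank_eq_two_iff, measure_hyperdet_pos hv ht hind]

end RealTensor

theorem proposition4p2 :
    (∀ r : ℕ, RealTensor.IsTypicalSubrank 2 2 2 r ↔ r = 1 ∨ r = 2) ∧
    (∀ {Ω : Type*} [MeasurableSpace Ω] (P : Measure Ω) [IsProbabilityMeasure P]
      (t : Fin 2 → Fin 2 → Fin 2 → Ω → ℝ) (v : ℝ≥0), v ≠ 0 →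
      (∀ i j k, HasLaw (t i j k) (gaussianReal 0 v) P) →
      iIndepFun (fun p : Fin 2 × Fin 2 × Fin 2 => t p.1 p.2.1 p.2.2) P →
      P {ω | RealTensor.subrank (fun i j k => t i j k ω) = 2} = ENNReal.ofReal (Real.pi / 4)) ∧
    (∀ T : RealTensor 2 2 2,
      (RealTensor.subrank T = 2 ↔ 0 < RealTensor.hyperdet T) ∧
      (RealTensor.hyperdet T ≠ 0 → (RealTensor.subrank T = 2 ↔ RealTensor.rank T = 2))) :=
  ⟨RealTensor.isTypicalSubrank_iff,
    fun P _ _ _ hv ht hind => RealTensor.measure_subrank_eq_two hv ht hind,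
    fun T => ⟨RealTensor.subrank_eq_two_iff T, fun hT => by
      rw [RealTensor.subrank_eq_two_iff, RealTensor.rank_eq_two_iff hT]⟩⟩
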